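/- Let $n>0$ and let $F_m$ be the class of all nondecreasing functions $f:[-\frac12,\frac12]\to\mathbb R$. One observes the path $Y=(Y(t))_{-1/2\le t\le 1/2}$ of the white noise model $$dY(t)=f(t)\,dt+n^{-1/2}\,dW(t),\qquad -\tfrac12\le t\le\tfrac12,$$ where $W$ is standard Brownian motion, and writes $P_f$, $E_f$ for probability and expectation when $f$ is the true function. For $\alpha\in(0,1)$ let $\mathcal I_\alpha(F_m)$ be the collection of all confidence intervals $\mathrm{CI}$ based on $Y$ (possibly empty or unbounded) with $P_g(g(0)\in \mathrm{CI})\ge 1-\alpha$ for every $g\in F_m$; let $L(\mathrm{CI})$ be the length of $\mathrm{CI}$ and $$L^*_\alpha(f,F_m)=\inf_{\mathrm{CI}\in\mathcal I_\alpha(F_m)}E_f\,L(\mathrm{CI}).$$ Let $z_\alpha=\Phi^{-1}(1-\alpha)$, with $\Phi$ the standard normal distribution function. For integers $j\ge2$ put $\sigma_j=\sqrt{2^{j-1}/n}$ and $$\xi_j=2^{j-1}\bigl(Y(2^{-j+1})-Y(2^{-j})\bigr)-2^{j-1}\bigl(Y(-2^{-j})-Y(-2^{-j+1})\bigr),$$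 and let $j_*^m$ be the smallest integer $j\ge2$ with $E_f\xi_j\le z_\alpha\sigma_j$. Theorem. Let $0<\alpha\le0.2$ and $f\in F_m$. Then $j_*^m$ exists and $$L^*_\alpha(f,F_m)\ \ge\ \Bigl(1-\frac{1}{\sqrt{2\pi}\,z_\alpha}\Bigr)\frac{1}{\sqrt2}\,z_\alpha\,\sigma_{j_*^m}.$$ -/

import Mathlib

open MeasureTheory ProbabilityTheory
open scoped ENNReal NNReal

noncomputable section

namespace MonotoneCI

/-- The time interval `[-1/2, 1/2]` on which the white noise model is observed. -/
abbrev TimeInterval : Type := Set.Icc (-(1 / 2) : ℝ) (1 / 2)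

/-- The sample space: paths `y : [-1/2, 1/2] → ℝ`, with the σ-algebra generated by the evaluations
(on continuous paths this is the Borel σ-algebra of uniform convergence). -/
abbrev Path : Type := TimeInterval → ℝ

/-- The value `y t` of a path at a real time `t`. It is only used at times `t ∈ [-1/2, 1/2]`;
other times are clamped to that interval. -/
def Path.at (y : Path) (t : ℝ) : ℝ :=
  y (Set.projIcc (-(1 / 2) : ℝ) (1 / 2) (by norm_num) t)

/-- The observed path of the white noise model `dY(t) = f(t) dt + n^{-1/2} dW(t)`,
`-1/2 ≤ t ≤ 1/2`, started from `Y(-1/2) = 0`. The driving Brownian motion is `W(t) = B (t + 1/2)`,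
where `B` is a standard Brownian motion indexed by `[0, ∞)`; `t + 1/2` is nonnegative for every
`t` in the time interval. -/
def whiteNoise {Ω : Type*} (B : ℝ≥0 → Ω → ℝ) (n : ℝ) (f : ℝ → ℝ) (ω : Ω) : Path :=
  fun t ↦ (∫ s in (-(1 / 2) : ℝ)..(t : ℝ), f s)
    + (Real.sqrt n)⁻¹ * B (Real.toNNReal ((t : ℝ) + 1 / 2)) ω

/-- The class `F_m` of functions that are nondecreasing on `[-1/2, 1/2]`
(values outside this interval play no role anywhere). -/
def monotoneClass : Set (ℝ → ℝ) :=
  {f | MonotoneOn f (Set.Icc (-(1 / 2) : ℝ) (1 / 2))}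

/-- An interval procedure based on the observed path: two measurable, possibly infinite
endpoints. -/
structure IntervalProcedure where
  /-- left endpoint -/
  lower : Path → EReal
  /-- right endpoint -/
  upper : Path → EReal
  measurable_lower : Measurable lower
  measurable_upper : Measurable upper

/-- The interval reported on seeing the path `y`; it is empty if the left endpoint exceeds the
right endpoint. -/
def IntervalProcedure.interval (C : IntervalProcedure) (y : Path) : Set ℝ :=
  {x : ℝ | C.lower y ≤ (x : EReal) ∧ (x : EReal) ≤ C.upper y}

/-- The length (Lebesgue measure) of the reported interval. -/
def IntervalProcedure.length (C : IntervalProcedure) (y : Path) : ℝ≥0∞ :=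
  volume (C.interval y)

section Benchmark

variable {Ω : Type*} [MeasurableSpace Ω]

/-- The collection of all confidence intervals that cover `f 0` with probability at least `1 - α`
for every `f` in the class `F`. -/
def confidenceIntervals (P : Measure Ω) (B : ℝ≥0 → Ω → ℝ) (n α : ℝ) (F : Set (ℝ → ℝ)) :
    Set IntervalProcedure :=
  {C | ∀ f ∈ F, ENNReal.ofReal (1 - α) ≤ P {ω | f 0 ∈ C.interval (whiteNoise B n f ω)}}

/-- The expected length of `C` when the true function is `f`. -/
def expectedLength (P : Measure Ω) (B : ℝ≥0 → Ω → ℝ) (n : ℝ) (C : IntervalProcedure)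
    (f : ℝ → ℝ) : ℝ≥0∞ :=
  ∫⁻ ω, C.length (whiteNoise B n f ω) ∂P

/-- The benchmark `L*_α(f, F)`: the smallest expected length at `f` among all confidence intervals
with guaranteed coverage `1 - α` over `F`. -/
def minExpectedLength (P : Measure Ω) (B : ℝ≥0 → Ω → ℝ) (n α : ℝ) (f : ℝ → ℝ)
    (F : Set (ℝ → ℝ)) : ℝ≥0∞ :=
  ⨅ C ∈ confidenceIntervals P B n α F, expectedLength P B n C f

/-- The normal quantile `z_α = Φ⁻¹(1 - α)`, with `Φ` the standard normal distribution function. -/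
def zQuantile (α : ℝ) : ℝ := sInf {x : ℝ | 1 - α ≤ cdf (gaussianReal 0 1) x}

/-- `σ_j`, given by `σ_j² = 2^{j-1} / n`. -/
def sigma (n : ℝ) (j : ℕ) : ℝ := Real.sqrt ((2 : ℝ) ^ ((j : ℤ) - 1) / n)

/-- The statistic
`ξ_j = 2^{j-1} (Y(2^{-j+1}) - Y(2^{-j})) - 2^{j-1} (Y(-2^{-j}) - Y(-2^{-j+1}))`, used for `j ≥ 2`. -/
def xi (j : ℕ) (y : Path) : ℝ :=
  (2 : ℝ) ^ ((j : ℤ) - 1) * (y.at ((2 : ℝ) ^ (-(j : ℤ) + 1)) - y.at ((2 : ℝ) ^ (-(j : ℤ))))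
    - (2 : ℝ) ^ ((j : ℤ) - 1) * (y.at (-(2 : ℝ) ^ (-(j : ℤ))) - y.at (-(2 : ℝ) ^ (-(j : ℤ) + 1)))

/-- The expectation `E_f ξ_j`. -/
def meanXi (P : Measure Ω) (B : ℝ≥0 → Ω → ℝ) (n : ℝ) (f : ℝ → ℝ) (j : ℕ) : ℝ :=
  ∫ ω, xi j (whiteNoise B n f ω) ∂P

/-- The levels `j ≥ 2` with `E_f ξ_j ≤ z_α σ_j`. -/
def levelSet (P : Measure Ω) (B : ℝ≥0 → Ω → ℝ) (n α : ℝ) (f : ℝ → ℝ) : Set ℕ :=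
  {j | 2 ≤ j ∧ meanXi P B n f j ≤ zQuantile α * sigma n j}

/-- `j_*^m`, the smallest level `j ≥ 2` with `E_f ξ_j ≤ z_α σ_j`. -/
def jStar (P : Measure Ω) (B : ℝ≥0 → Ω → ℝ) (n α : ℝ) (f : ℝ → ℝ) : ℕ :=
  sInf (levelSet P B n α f)

end Benchmark

end MonotoneCI

end

/-! The bound is a two-point argument spread over a segment. Write z for `zQuantile α`, and let g be
monotone with L²-distance at most z/√n from f. Every f_t = f + t(g - f), 0 ≤ t ≤ 1, is monotone, so
the interval covers f_t(0) with probability at least 1 - α = Φ(z) under f_t. Passing from f_t to f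
is a drift of norm at most tz for the standardised noise, so by Neyman–Pearson the coverage of
f_t(0) under f is still at least Φ(z - tz) (`stdCDF_le_coverage`). By Tonelli the expected length at
f is at least |g(0) - f(0)| ∫₀¹ Φ(z - tz) dt (`le_expectedLength`), and the Mills ratio bound gives
∫₀¹ Φ(z - tz) dt ≥ 1 - 1/(√(2π) z).

It remains to find g with |g(0) - f(0)| = a = zσ_j/√2 at j = j_*^m (`exists_alternative`). Raising f
to the level f(0) + a to the right of 0 costs at most l a² in squared distance if f reaches that
level within distance l; lowering it on the left is symmetric. With l = 2^{2-j} the cost is exactly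
z²/n. For j ≥ 3, minimality of j says that E ξ_{j-1} exceeds zσ_{j-1} = a, while E ξ_{j-1} is at
most half the increment of f over [-l, l]; hence f moves by a on one of the two sides. For j = 2 the
time interval itself stops at 1/2.

The Neyman–Pearson step for paths avoids a likelihood ratio on path space: at finitely many times a
drift acts on one Gaussian coordinate only, independent of the rest, and general events are
approximated by cylinders. -/

noncomputable section

namespace MonotoneCI

/-! ### Neyman–Pearson on the real line -/

/-- The standard normal distribution function. -/
def stdCDF (x : ℝ) : ℝ := (gaussianReal 0 1).real (Set.Iic x)

lemma stdCDF_nonneg (x : ℝ) : 0 ≤ stdCDF x := measureReal_nonneg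

lemma stdCDF_mono : Monotone stdCDF := fun _ _ h ↦ measureReal_mono (Set.Iic_subset_Iic.2 h)

lemma gaussianReal_real_eq_setIntegral (μ : ℝ) (A : Set ℝ) :
    (gaussianReal μ 1).real A = ∫ x in A, gaussianPDFReal μ 1 x := by
  rw [measureReal_def, gaussianReal_apply_eq_integral μ one_ne_zero, ENNReal.toReal_ofReal]
  exact integral_nonneg fun x ↦ gaussianPDFReal_nonneg μ 1 x

lemma gaussianReal_real_Ici_neg (x : ℝ) : (gaussianReal 0 1).real (Set.Ici (-x)) = stdCDF x := by
  have h : (gaussianReal 0 1).map (fun x : ℝ ↦ -x) = gaussianReal 0 1 := by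
    simpa using gaussianReal_map_neg (μ := 0) (v := 1)
  rw [stdCDF, ← h, map_measureReal_apply measurable_neg measurableSet_Ici, h]
  congr 1
  ext y
  simp

/-- The Neyman–Pearson inequality for testing between `N(0, 1)` and `N(v, 1)`. -/
lemma neymanPearson_gaussianReal (z : ℝ) {v : ℝ} (hv : 0 ≤ v) {A : Set ℝ} (hA : MeasurableSet A) :
    stdCDF (z - v) + Real.exp (z * v - v ^ 2 / 2)
        * ((gaussianReal 0 1).real ((· + v) ⁻¹' A) - stdCDF z)
      ≤ (gaussianReal 0 1).real A := by
  set k := Real.exp (z * v - v ^ 2 / 2) with hk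
  set S : Set ℝ := Set.Ici (v - z) with hS
  have hshift (T : Set ℝ) (hT : MeasurableSet T) : (gaussianReal 0 1).real ((· + v) ⁻¹' T)
      = ∫ x in T, gaussianPDFReal v 1 x := by
    rw [← gaussianReal_real_eq_setIntegral, ← map_measureReal_apply (by fun_prop) hT,
      gaussianReal_map_add_const, zero_add]
  have h1 : stdCDF (z - v) = ∫ x in S, gaussianPDFReal 0 1 x := by
    rw [← gaussianReal_real_Ici_neg, gaussianReal_real_eq_setIntegral, hS, neg_sub]
  have h2 : stdCDF z = ∫ x in S, gaussianPDFReal v 1 x := by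
    rw [← hshift S measurableSet_Ici, ← gaussianReal_real_Ici_neg]
    congr 1
    ext y
    simp only [hS, Set.mem_Ici, Set.mem_preimage]
    constructor <;> intro h <;> linarith
  have hint (μ : ℝ) : Integrable (gaussianPDFReal μ 1) := integrable_gaussianPDFReal μ 1
  set q : ℝ → ℝ := fun x ↦ gaussianPDFReal 0 1 x - k * gaussianPDFReal v 1 x with hq
  have hqi : Integrable q := (hint 0).sub ((hint v).const_mul k)
  have hsplit (T : Set ℝ) : ∫ x in T, q x
      = (∫ x in T, gaussianPDFReal 0 1 x) - k * ∫ x in T, gaussianPDFReal v 1 x := by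
    rw [hq, integral_sub (hint 0).integrableOn ((hint v).const_mul k).integrableOn,
      integral_const_mul]
  -- The likelihood ratio is monotone, and `k` is its reciprocal at the cut point `v - z`. So `q` is
  -- nonpositive exactly on `S` when `v > 0`, and `S` minimises the integral of `q` over all
  -- measurable sets.
  have hpt (x : ℝ) : k * gaussianPDFReal v 1 x
      = gaussianPDFReal 0 1 x * Real.exp (v * (x - (v - z))) := by
    simp only [gaussianPDFReal, hk]
    rw [mul_left_comm, mul_assoc (√_)⁻¹, ← Real.exp_add, ← Real.exp_add]
    congr 2
    push_cast
    ring
  have hle : ∫ x in S, q x ≤ ∫ x in A, q x := by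
    rw [← integral_indicator measurableSet_Ici, ← integral_indicator hA]
    refine integral_mono (hqi.indicator measurableSet_Ici) (hqi.indicator hA) fun x ↦ ?_
    have hφ := gaussianPDFReal_nonneg 0 1 x
    change S.indicator q x ≤ A.indicator q x
    by_cases hx : x ∈ S
    · have : q x ≤ 0 := by
        have hx' : v - z ≤ x := hx
        have : 1 ≤ Real.exp (v * (x - (v - z))) :=
          Real.one_le_exp (mul_nonneg hv (by linarith))
        simp only [hq, hpt]
        nlinarith
      by_cases hxA : x ∈ A <;> simp only [Set.indicator_of_mem, Set.indicator_of_notMem, hx, hxA, not_false_eq_true, this, le_refl]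
    · have : 0 ≤ q x := by
        have hx' : x < v - z := not_le.1 hx
        have : Real.exp (v * (x - (v - z))) ≤ 1 :=
          Real.exp_le_one_iff.2 (mul_nonpos_of_nonneg_of_nonpos hv (by linarith))
        simp only [hq, hpt]
        nlinarith
      by_cases hxA : x ∈ A <;> simp only [Set.indicator_of_mem, Set.indicator_of_notMem, hx, hxA, not_false_eq_true, this, le_refl]
  rw [hsplit, hsplit, ← h1, ← h2, ← hshift A hA, ← gaussianReal_real_eq_setIntegral] at hle
  linarith

/-! ### Calculus of Φ: Mills ratio, averaged power, quantile -/

lemma hasDerivAt_gaussianPDFReal (x : ℝ) :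
    HasDerivAt (gaussianPDFReal 0 1) (-x * gaussianPDFReal 0 1 x) x := by
  have h : gaussianPDFReal 0 1 = fun x ↦ (√(2 * Real.pi * (1 : ℝ≥0)))⁻¹
      * Real.exp (-(x - 0) ^ 2 / (2 * (1 : ℝ≥0))) := by
    ext; simp [gaussianPDFReal]
  have h1 : HasDerivAt (fun x : ℝ ↦ -(x - 0) ^ 2 / (2 * ((1 : ℝ≥0) : ℝ))) (-x) x := by
    have := (((hasDerivAt_id x).sub_const 0).pow 2).neg.div_const (2 * ((1 : ℝ≥0) : ℝ))
    exact this.congr_deriv (by simp; ring)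
  rw [h]
  exact (h1.exp.const_mul _).congr_deriv (by ring)

lemma continuous_gaussianPDFReal : Continuous (gaussianPDFReal 0 1) :=
  continuous_iff_continuousAt.2 fun x ↦ (hasDerivAt_gaussianPDFReal x).continuousAt

lemma hasDerivAt_stdCDF (x : ℝ) : HasDerivAt stdCDF (gaussianPDFReal 0 1 x) x := by
  have hint : Integrable (gaussianPDFReal 0 1) := integrable_gaussianPDFReal 0 1
  have h : stdCDF = fun x ↦ stdCDF 0 + ∫ t in (0 : ℝ)..x, gaussianPDFReal 0 1 t := by
    ext y
    rw [← intervalIntegral.integral_Iic_sub_Iic hint.integrableOn hint.integrableOn]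
    simp [stdCDF, gaussianReal_real_eq_setIntegral]
  rw [h]
  exact (intervalIntegral.integral_hasDerivAt_right hint.intervalIntegrable
    hint.1.stronglyMeasurableAtFilter continuous_gaussianPDFReal.continuousAt).const_add _

lemma continuous_stdCDF : Continuous stdCDF :=
  continuous_iff_continuousAt.2 fun x ↦ (hasDerivAt_stdCDF x).continuousAt

lemma stdCDF_zero : stdCDF 0 = 1 / 2 := by
  have h := gaussianReal_real_Ici_neg 0
  have h2 : (gaussianReal 0 1).real (Set.Iio 0) = stdCDF 0 := by
    have := nullSingletonClass_gaussianReal (μ := 0) (v := 1) one_ne_zero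
    exact measureReal_congr Iio_ae_eq_Iic
  have h3 := probReal_add_probReal_compl (μ := gaussianReal 0 1)
    (measurableSet_Ici (a := (0 : ℝ)))
  rw [Set.compl_Ici, h2] at h3
  rw [neg_zero] at h
  linarith

lemma stdCDF_eq_cdf : stdCDF = cdf (gaussianReal 0 1) := by
  ext x
  rw [cdf_eq_real, stdCDF]

lemma tendsto_stdCDF_atTop : Filter.Tendsto stdCDF Filter.atTop (nhds 1) := by
  rw [stdCDF_eq_cdf]
  exact tendsto_cdf_atTop _

/-- The Mills ratio bound. -/
lemma one_le_stdCDF_add {z : ℝ} (hz : 0 < z) : 1 ≤ stdCDF z + gaussianPDFReal 0 1 z / z := by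
  -- The derivative of `m` is -φ(x)/x², so `m` decreases on (0, ∞) to its limit 1.
  set m : ℝ → ℝ := fun x ↦ stdCDF x + gaussianPDFReal 0 1 x / x
  have hd (x : ℝ) (hx : 0 < x) : HasDerivAt m (-(gaussianPDFReal 0 1 x / x ^ 2)) x := by
    have := (hasDerivAt_stdCDF x).add
      ((hasDerivAt_gaussianPDFReal x).div (hasDerivAt_id x) hx.ne')
    refine this.congr_deriv ?_
    simp only [id_eq]
    field_simp
    ring
  have hanti : AntitoneOn m (Set.Ioi 0) := by
    refine antitoneOn_of_deriv_nonpos (convex_Ioi 0)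
      (fun x hx ↦ (hd x hx).continuousAt.continuousWithinAt) ?_ ?_
    · intro x hx
      rw [interior_Ioi] at hx
      exact (hd x hx).differentiableAt.differentiableWithinAt
    · intro x hx
      rw [interior_Ioi] at hx
      rw [(hd x hx).deriv]
      exact neg_nonpos.2 (div_nonneg (gaussianPDFReal_nonneg _ _ _) (sq_nonneg _))
  have hlim : Filter.Tendsto m Filter.atTop (nhds 1) := by
    have h0 : Filter.Tendsto (fun x ↦ gaussianPDFReal 0 1 x / x) Filter.atTop (nhds 0) := by
      refine squeeze_zero' (g := fun x : ℝ ↦ (√(2 * Real.pi))⁻¹ / x) ?_ ?_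
        (Filter.Tendsto.div_atTop tendsto_const_nhds Filter.tendsto_id)
      · filter_upwards [Filter.eventually_gt_atTop 0] with x hx
        exact div_nonneg (gaussianPDFReal_nonneg _ _ _) hx.le
      · filter_upwards [Filter.eventually_gt_atTop 0] with x hx
        gcongr
        simp only [gaussianPDFReal, NNReal.coe_one, mul_one, sub_zero]
        refine mul_le_of_le_one_right (by positivity) (Real.exp_le_one_iff.2 ?_)
        have := sq_nonneg x
        linarith
    simpa using tendsto_stdCDF_atTop.add h0
  refine le_of_tendsto hlim ?_
  filter_upwards [Filter.eventually_ge_atTop z] with x hx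
  exact hanti hz (hz.trans_le hx) hx

/-- The integral of the power of the tests along a segment from the alternative to the null. -/
lemma one_sub_le_integral_stdCDF {z : ℝ} (hz : 0 < z) :
    1 - 1 / (Real.sqrt (2 * Real.pi) * z) ≤ ∫ t in (0 : ℝ)..1, stdCDF (z - t * z) := by
  -- An antiderivative of Φ, since φ'(u) = -uφ(u).
  set G : ℝ → ℝ := fun u ↦ u * stdCDF u + gaussianPDFReal 0 1 u
  have hG (u : ℝ) : HasDerivAt G (stdCDF u) u := by
    have := ((hasDerivAt_id u).mul (hasDerivAt_stdCDF u)).add (hasDerivAt_gaussianPDFReal u)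
    exact this.congr_deriv (by simp)
  have h1 : ∫ t in (0 : ℝ)..1, stdCDF (z - t * z) = z⁻¹ * (G z - G 0) := by
    rw [← intervalIntegral.integral_eq_sub_of_hasDerivAt (fun u _ ↦ hG u)
      (continuous_stdCDF.intervalIntegrable _ _)]
    have := intervalIntegral.integral_comp_sub_mul (a := 0) (b := 1) stdCDF hz.ne' z
    simp only [mul_zero, mul_one, sub_self, sub_zero, smul_eq_mul] at this
    rw [← this]
    simp only [mul_comm]
  have h2 := one_le_stdCDF_add hz
  have h3 : gaussianPDFReal 0 1 0 = 1 / √(2 * Real.pi) := by simp [gaussianPDFReal]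
  have h4 : z⁻¹ * (G z - G 0)
      = stdCDF z + gaussianPDFReal 0 1 z / z - 1 / (√(2 * Real.pi) * z) := by
    simp only [G, h3]
    field_simp
    ring
  rw [h1, h4]
  linarith

lemma stdCDF_zQuantile {α : ℝ} (hα₀ : 0 < α) (hα₁ : α < 1 / 2) :
    0 < zQuantile α ∧ stdCDF (zQuantile α) = 1 - α := by
  have hz : zQuantile α = sInf {x : ℝ | 1 - α ≤ stdCDF x} := by
    rw [zQuantile, stdCDF_eq_cdf]
  set T := {x : ℝ | 1 - α ≤ stdCDF x} with hT
  have hcl : IsClosed T := isClosed_le continuous_const continuous_stdCDF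
  have hne : T.Nonempty := by
    obtain ⟨x, hx⟩ := (tendsto_stdCDF_atTop.eventually (le_mem_nhds (by linarith : 1 - α < 1))).exists
    exact ⟨x, hx⟩
  have hlow : ∀ x ∈ T, 0 < x := by
    intro x hx
    by_contra! h
    have h1 := stdCDF_mono h
    rw [stdCDF_zero] at h1
    have : 1 - α ≤ stdCDF x := hx
    linarith
  have hbdd : BddBelow T := ⟨0, fun x hx ↦ (hlow x hx).le⟩
  have hmem : sInf T ∈ T := hcl.csInf_mem hne hbdd
  rw [hz]
  -- Points below the infimum have Φ < 1 - α; continuity carries this to the infimum from the left.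
  refine ⟨hlow _ hmem, le_antisymm ?_ hmem⟩
  refine le_of_tendsto (continuous_stdCDF.continuousAt.tendsto.mono_left
    (nhdsWithin_le_nhds (s := Set.Iio (sInf T)))) ?_
  filter_upwards [self_mem_nhdsWithin] with x hx
  exact (not_le.1 fun h ↦ notMem_of_lt_csInf hx hbdd h).le

/-! ### Neyman–Pearson for Brownian motion with drift -/

/-- The Neyman–Pearson inequality for a shift of a standard Gaussian coordinate that is independent
of the remaining observations. -/
lemma neymanPearson_of_indepFun {Ω E : Type*} [MeasurableSpace Ω] [MeasurableSpace E]
    {P : Measure Ω} [IsProbabilityMeasure P] {R : Ω → E} {N : Ω → ℝ} (hR : Measurable R)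
    (hN : Measurable N) (hlaw : P.map N = gaussianReal 0 1) (hind : IndepFun R N P)
    (z : ℝ) {v : ℝ} (hv : 0 ≤ v) {S : Set (E × ℝ)} (hS : MeasurableSet S) :
    stdCDF (z - v) + Real.exp (z * v - v ^ 2 / 2)
        * (P.real {ω | (R ω, N ω + v) ∈ S} - stdCDF z)
      ≤ P.real {ω | (R ω, N ω) ∈ S} := by
  have : IsProbabilityMeasure (P.map R) := Measure.isProbabilityMeasure_map hR.aemeasurable
  have hprod := (indepFun_iff_map_prod_eq_prod_map_map hR.aemeasurable hN.aemeasurable).1 hind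
  rw [hlaw] at hprod
  have key {T : Set (E × ℝ)} (hT : MeasurableSet T) :
      P.real {ω | (R ω, N ω) ∈ T} = ∫ r, (gaussianReal 0 1).real (Prod.mk r ⁻¹' T) ∂(P.map R) := by
    have h1 : P.real {ω | (R ω, N ω) ∈ T} = ((P.map R).prod (gaussianReal 0 1)).real T := by
      rw [← hprod, map_measureReal_apply (hR.prodMk hN) hT]
      rfl
    rw [h1, measureReal_def, Measure.prod_apply hT, ← integral_toReal
      (measurable_measure_prodMk_left hT).aemeasurable (by simp)]
    rfl
  have hint {T : Set (E × ℝ)} (hT : MeasurableSet T) :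
      Integrable (fun r ↦ (gaussianReal 0 1).real (Prod.mk r ⁻¹' T)) (P.map R) := by
    refine Integrable.of_bound (C := 1)
      (measurable_measure_prodMk_left hT).ennreal_toReal.aestronglyMeasurable (.of_forall fun r ↦ ?_)
    rw [Real.norm_of_nonneg measureReal_nonneg]
    exact measureReal_le_one
  set T : Set (E × ℝ) := (fun p ↦ (p.1, p.2 + v)) ⁻¹' S with hT
  have hTm : MeasurableSet T := by
    refine measurableSet_preimage ?_ hS
    fun_prop
  have hTS : {ω | (R ω, N ω + v) ∈ S} = {ω | (R ω, N ω) ∈ T} := rfl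
  rw [hTS, key hS, key hTm]
  set k := Real.exp (z * v - v ^ 2 / 2)
  have hi : Integrable (fun r ↦ k * ((gaussianReal 0 1).real (Prod.mk r ⁻¹' T) - stdCDF z))
      (P.map R) := ((hint hTm).sub (integrable_const _)).const_mul k
  -- The one-dimensional inequality is affine in the power, with coefficients that do not depend on
  -- `r`, so its fibrewise form integrates over the law of `R`.
  have h0 : stdCDF (z - v)
        + k * (∫ r, (gaussianReal 0 1).real (Prod.mk r ⁻¹' T) ∂(P.map R) - stdCDF z)
      = ∫ r, (stdCDF (z - v) + k * ((gaussianReal 0 1).real (Prod.mk r ⁻¹' T) - stdCDF z))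
          ∂(P.map R) := by
    rw [integral_add (integrable_const _) hi, integral_const_mul, integral_sub (hint hTm) (integrable_const _)]
    simp
  rw [h0]
  exact integral_mono
    ((integrable_const _).add hi) (hint hS)
    fun r ↦ neymanPearson_gaussianReal z hv (measurable_prodMk_left hS)

/-- Time elapsed since the start `-1/2` of the observation. -/
def clock (t : TimeInterval) : ℝ≥0 := Real.toNNReal ((t : ℝ) + 1 / 2)

lemma coe_clock (t : TimeInterval) : (clock t : ℝ) = t + 1 / 2 :=
  Real.coe_toNNReal _ (by linarith [t.2.1])

/-- Lebesgue measure on the time interval. -/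
def timeVolume : Measure ℝ := volume.restrict (Set.Icc (-(1 / 2) : ℝ) (1 / 2))

instance : IsFiniteMeasure timeVolume := by
  unfold timeVolume
  infer_instance

/-- The projection in `L²` of a drift onto the span of the indicators of `[-1/2, t]`, `t ∈ I`. -/
lemma exists_coeff_of_drift (I : Finset TimeInterval) {h : ℝ → ℝ} (hh : MemLp h 2 timeVolume) :
    ∃ c : I → ℝ,
      (∀ t : I, ∑ s, c s * ((min (clock s) (clock t) : ℝ≥0) : ℝ)
        = ∫ x in (-(1 / 2) : ℝ)..(t : TimeInterval), h x) ∧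
      ∑ s, ∑ t, c s * (c t * ((min (clock s) (clock t) : ℝ≥0) : ℝ))
        ≤ ∫ x in (-(1 / 2) : ℝ)..(1 / 2), h x ^ 2 ∧
      (∑ s, ∑ t, c s * (c t * ((min (clock s) (clock t) : ℝ≥0) : ℝ)) = 0 →
        ∀ t : I, ∫ x in (-(1 / 2) : ℝ)..(t : TimeInterval), h x = 0) := by
  have hm (t : TimeInterval) : MeasurableSet (Set.Icc (-(1 / 2) : ℝ) t) := measurableSet_Icc
  -- The Gram matrix of these indicators is the Brownian covariance. The coefficients of the
  -- projection of `h` onto their span therefore reproduce the drift at the times in `I`, and their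
  -- quadratic form, the squared norm of the projection, is at most ‖h‖².
  let e : I → Lp ℝ 2 timeVolume := fun t ↦
    indicatorConstLp 2 (hm t) (measure_ne_top timeVolume (Set.Icc (-(1 / 2) : ℝ) t)) 1
  let g : Lp ℝ 2 timeVolume := hh.toLp h
  have hee (s t : I) : inner ℝ (e s) (e t) = ((min (clock s) (clock t) : ℝ≥0) : ℝ) := by
    have h1 : inner ℝ (e s) (e t)
        = timeVolume.real (Set.Icc (-(1 / 2) : ℝ) s ∩ Set.Icc (-(1 / 2) : ℝ) t) :=
      L2.real_inner_indicatorConstLp_one_indicatorConstLp_one (hm s) (hm t)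
    have hs := s.1.2
    have ht := t.1.2
    rw [h1, timeVolume, Set.Icc_inter_Icc, sup_idem, measureReal_restrict_apply measurableSet_Icc,
      Set.Icc_inter_Icc, sup_idem, min_eq_left (inf_le_left.trans hs.2), Real.volume_real_Icc_of_le
      (le_min hs.1 ht.1), NNReal.coe_min, coe_clock, coe_clock, min_add_add_right]
    ring
  have heg (t : I) : inner ℝ (e t) g = ∫ x in (-(1 / 2) : ℝ)..(t : TimeInterval), h x := by
    have ht := t.1.2
    rw [L2.inner_indicatorConstLp_one, integral_congr_ae (ae_restrict_of_ae hh.coeFn_toLp),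
      timeVolume, Measure.restrict_restrict (hm t), Set.Icc_inter_Icc, sup_idem, min_eq_left ht.2,
      intervalIntegral.integral_of_le ht.1, integral_Icc_eq_integral_Ioc]
  have hgg : inner ℝ g g = ∫ x in (-(1 / 2) : ℝ)..(1 / 2), h x ^ 2 := by
    rw [L2.inner_def, intervalIntegral.integral_of_le (by norm_num),
      ← integral_Icc_eq_integral_Ioc]
    refine integral_congr_ae ?_
    filter_upwards [hh.coeFn_toLp] with x hx
    simp only [g, hx]
    simp [sq]
  let K : Submodule ℝ (Lp ℝ 2 timeVolume) := Submodule.span ℝ (Set.range e)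
  have : FiniteDimensional ℝ K := FiniteDimensional.span_of_finite ℝ (Set.finite_range e)
  obtain ⟨c, hc⟩ := (Submodule.mem_span_range_iff_exists_fun ℝ).1
    (Submodule.starProjection_apply_mem K g)
  have hH (t : I) : inner ℝ (K.starProjection g) (e t)
      = ∫ x in (-(1 / 2) : ℝ)..(t : TimeInterval), h x := by
    have h1 := K.starProjection_inner_eq_zero g (e t) (Submodule.subset_span ⟨t, rfl⟩)
    rw [inner_sub_left, sub_eq_zero, real_inner_comm, heg] at h1
    exact h1.symm
  have hvar : inner ℝ (K.starProjection g) (K.starProjection g)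
      = ∑ s, ∑ t, c s * (c t * ((min (clock s) (clock t) : ℝ≥0) : ℝ)) := by
    rw [← hc, sum_inner]
    refine Finset.sum_congr rfl fun s _ ↦ ?_
    rw [inner_sum]
    refine Finset.sum_congr rfl fun t _ ↦ ?_
    rw [real_inner_smul_left, real_inner_smul_right, hee]
  refine ⟨c, fun t ↦ ?_, ?_, fun h0 t ↦ ?_⟩
  · rw [← hH, ← hc, sum_inner]
    exact Finset.sum_congr rfl fun s _ ↦ by rw [real_inner_smul_left, hee]
  · rw [← hvar, ← hgg, real_inner_self_eq_norm_sq, real_inner_self_eq_norm_sq]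
    gcongr
    exact K.norm_starProjection_apply_le g
  · rw [← hH, inner_self_eq_zero.1 (hvar.trans h0), inner_zero_left]

variable {Ω : Type*} [MeasurableSpace Ω] {P : Measure Ω} {B : ℝ≥0 → Ω → ℝ}

/-- The Neyman–Pearson inequality for a drift of Brownian motion observed at finitely many times. -/
lemma neymanPearson_restrict [IsProbabilityMeasure P] (hBmeas : ∀ t, Measurable (B t))
    (hB : IsPreBrownianReal B P) (I : Finset TimeInterval) {h : ℝ → ℝ}
    (hh : MemLp h 2 timeVolume) {d : ℝ} (hd : 0 ≤ d)
    (hhd : ∫ x in (-(1 / 2) : ℝ)..(1 / 2), h x ^ 2 ≤ d ^ 2) (z : ℝ) {S : Set (I → ℝ)}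
    (hS : MeasurableSet S) :
    ∃ v, 0 ≤ v ∧ v ≤ d ∧ stdCDF (z - v) + Real.exp (z * v - v ^ 2 / 2)
        * (P.real {ω | (fun t : I ↦ B (clock t) ω + ∫ x in (-(1 / 2) : ℝ)..(t : TimeInterval), h x)
          ∈ S} - stdCDF z)
      ≤ P.real {ω | (fun t : I ↦ B (clock t) ω) ∈ S} := by
  obtain ⟨c, hcH, hcV, hc0⟩ := exists_coeff_of_drift I hh
  set H : I → ℝ := fun t ↦ ∫ x in (-(1 / 2) : ℝ)..(t : TimeInterval), h x
  set V : ℝ := ∑ s, ∑ t, c s * (c t * ((min (clock s) (clock t) : ℝ≥0) : ℝ)) with hV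
  have hmem (t : ℝ≥0) : MemLp (B t) 2 P := (hB.isGaussianProcess.hasGaussianLaw_eval t).memLp_two
  have hmem' (s : I) : MemLp (fun ω ↦ c s * B (clock s) ω) 2 P := (hmem _).const_mul _
  -- The sufficient statistic for the drift: its covariance with the value at time `t` is the drift
  -- `H t`.
  set N : Ω → ℝ := fun ω ↦ ∑ s, c s * B (clock s) ω with hN
  have hNmeas : Measurable N := by fun_prop
  have hNmem : MemLp N 2 P := memLp_finsetSum _ fun s _ ↦ hmem' s
  have hNB (t : I) : cov[N, B (clock t); P] = H t := by
    rw [hN, covariance_fun_sum_left hmem' (hmem _)]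
    refine Eq.trans (Finset.sum_congr rfl fun s _ ↦ ?_) (hcH t)
    rw [covariance_const_mul_left, hB.covariance_eval]
  have hNN : Var[N; P] = V := by
    rw [hN, variance_fun_sum hmem']
    refine Finset.sum_congr rfl fun s _ ↦ Finset.sum_congr rfl fun t _ ↦ ?_
    rw [covariance_const_mul_left, covariance_const_mul_right, hB.covariance_eval]
  have hV0 : 0 ≤ V := hNN ▸ variance_nonneg _ _
  rcases hV0.eq_or_lt with hV0 | hVpos
  -- Degenerate case: the drift vanishes at every observed time, so both laws agree on `S`.
  · refine ⟨0, le_rfl, hd, ?_⟩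
    have : ∀ t, H t = 0 := hc0 hV0.symm
    change stdCDF (z - 0) + _ * (P.real {ω | (fun t : I ↦ B (clock t) ω + H t) ∈ S} - _) ≤ _
    simp [this]
  set v := √V with hv
  have hvpos : 0 < v := Real.sqrt_pos.2 hVpos
  have hvv : v ^ 2 = V := Real.sq_sqrt hVpos.le
  refine ⟨v, hvpos.le, abs_le_of_sq_le_sq' (hvv.trans_le (hcV.trans hhd)) hd |>.2, ?_⟩
  set N' : Ω → ℝ := fun ω ↦ v⁻¹ * N ω with hN'
  -- The regression residual is uncorrelated with `N'`, hence independent of it by joint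
  -- Gaussianity. Adding the drift leaves `R` fixed and shifts `N'` by `v`.
  set R : I → Ω → ℝ := fun t ω ↦ B (clock t) ω - H t / v * N' ω with hR
  have hN'meas : Measurable N' := by fun_prop
  have hN'mem : MemLp N' 2 P := hNmem.const_mul _
  have hRmeas (t : I) : Measurable (R t) := by fun_prop
  have hgauss : IsGaussianProcess (Sum.elim (fun _ : Unit ↦ N') R) P := by
    let X : I → Ω → ℝ := fun t ↦ B (clock t)
    have hX : IsGaussianProcess X P := hB.isGaussianProcess.comp_right (fun t : I ↦ clock t)
    let ev (t : I) : (↥(Finset.univ : Finset I) → ℝ) →L[ℝ] ℝ :=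
      ContinuousLinearMap.proj ⟨t, Finset.mem_univ t⟩
    have hev (t : I) (ω : Ω) :
        ev t (Finset.restrict (Finset.univ : Finset I) fun t ↦ X t ω) = B (clock t) ω := rfl
    refine hX.of_isGaussianProcess fun s ↦ ⟨Finset.univ, ?_⟩
    have hL (ω : Ω) : N' ω = (v⁻¹ • ∑ t, c t • ev t)
        (Finset.restrict (Finset.univ : Finset I) fun t ↦ X t ω) := by
      simp only [hN', hN, smul_apply, sum_apply, hev, smul_eq_mul]
    rcases s with u | t
    · exact ⟨v⁻¹ • ∑ t, c t • ev t, hL⟩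
    · refine ⟨ev t - (H t / v) • (v⁻¹ • ∑ t, c t • ev t), fun ω ↦ ?_⟩
      rw [sub_apply, smul_apply, ← hL, hev, smul_eq_mul]
      rfl
  have hN'N' : Var[N'; P] = 1 := by
    rw [hN', variance_const_mul, hNN, ← hvv]
    field_simp
  have hN'mean : ∫ ω, N' ω ∂P = 0 := by
    simp only [hN', hN]
    rw [integral_const_mul, integral_finsetSum _ fun s _ ↦ (hB.integrable_eval _).const_mul _]
    simp [integral_const_mul, hB.integral_eval]
  have hcov (t : I) : cov[N', R t; P] = 0 := by
    have h1 : cov[N', B (clock t); P] = H t / v := by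
      rw [hN', covariance_const_mul_left, hNB, inv_mul_eq_div]
    rw [hR, covariance_fun_sub_right hN'mem (hmem _) (hN'mem.const_mul _),
      covariance_const_mul_right, covariance_self hN'meas.aemeasurable, hN'N']
    change cov[N', B (clock t); P] - _ = 0
    rw [h1]
    ring
  have hind := hgauss.indepFun_of_covariance_eq_zero (fun _ ↦ hN'meas.aemeasurable)
    (fun t ↦ (hRmeas t).aemeasurable) fun _ t ↦ hcov t
  have hind' : IndepFun (fun ω t ↦ R t ω) N' P :=
    (hind.comp (measurable_pi_apply ()) measurable_id).symm
  have hlaw : P.map N' = gaussianReal 0 1 := by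
    have h1 := (hgauss.hasGaussianLaw_eval (Sum.inl ())).map_eq_gaussianReal
    simpa [hN'N', hN'mean] using h1
  have hSm : MeasurableSet {p : (I → ℝ) × ℝ | (fun t ↦ p.1 t + H t / v * p.2) ∈ S} := by
    refine measurableSet_preimage (f := fun p : (I → ℝ) × ℝ ↦ fun t ↦ p.1 t + H t / v * p.2) ?_ hS
    fun_prop
  have key := neymanPearson_of_indepFun (measurable_pi_lambda _ hRmeas) hN'meas hlaw hind' z
    hvpos.le hSm
  have e1 (ω : Ω) (t : I) : R t ω + H t / v * (N' ω + v) = B (clock t) ω + H t := by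
    simp only [hR]
    field_simp
    ring
  have e2 (ω : Ω) (t : I) : R t ω + H t / v * N' ω = B (clock t) ω := by
    simp only [hR]
    ring
  have e1' (ω : Ω) : (fun t : I ↦ B (clock t) ω + ∫ x in (-(1 / 2) : ℝ)..(t : TimeInterval), h x)
      = fun t ↦ R t ω + H t / v * (N' ω + v) := funext fun t ↦ (e1 ω t).symm
  have e2' (ω : Ω) : (fun t : I ↦ B (clock t) ω) = fun t ↦ R t ω + H t / v * N' ω :=
    funext fun t ↦ (e2 ω t).symm
  simp_rw [e1', e2']
  exact key

/-- The drift path `t ↦ ∫_{-1/2}^t h`. -/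
def driftPath (h : ℝ → ℝ) : Path := fun t ↦ ∫ x in (-(1 / 2) : ℝ)..(t : ℝ), h x

/-- Brownian motion started at time `-1/2`. -/
def noisePath (B : ℝ≥0 → Ω → ℝ) (ω : Ω) : Path := fun t ↦ B (clock t) ω

lemma measurable_noisePath (hBmeas : ∀ t, Measurable (B t)) : Measurable (noisePath B) :=
  measurable_pi_lambda _ fun t ↦ hBmeas (clock t)

/-- An event that has probability at least `Φ(z)` for Brownian motion with drift `h` has probability
at least `Φ(z - ‖h‖)` for Brownian motion. -/
lemma stdCDF_sub_le_of_drift [IsProbabilityMeasure P] (hBmeas : ∀ t, Measurable (B t))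
    (hB : IsPreBrownianReal B P) {h : ℝ → ℝ}
    (hh : MemLp h 2 timeVolume) {d : ℝ} (hd : 0 ≤ d)
    (hhd : ∫ x in (-(1 / 2) : ℝ)..(1 / 2), h x ^ 2 ≤ d ^ 2) {z : ℝ} {A : Set Path}
    (hA : MeasurableSet A) (hAz : stdCDF z ≤ P.real {ω | noisePath B ω + driftPath h ∈ A}) :
    stdCDF (z - d) ≤ P.real {ω | noisePath B ω ∈ A} := by
  have hW := measurable_noisePath hBmeas
  have hWh : Measurable fun ω ↦ noisePath B ω + driftPath h := hW.add_const _
  set μ₀ := P.map (noisePath B) with hμ₀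
  set μ₁ := P.map (fun ω ↦ noisePath B ω + driftPath h) with hμ₁
  have : IsProbabilityMeasure μ₀ := Measure.isProbabilityMeasure_map hW.aemeasurable
  have : IsProbabilityMeasure μ₁ := Measure.isProbabilityMeasure_map hWh.aemeasurable
  have e0 {T : Set Path} (hT : MeasurableSet T) : P.real {ω | noisePath B ω ∈ T} = μ₀.real T :=
    (map_measureReal_apply hW hT).symm
  have e1 {T : Set Path} (hT : MeasurableSet T) :
      P.real {ω | noisePath B ω + driftPath h ∈ T} = μ₁.real T :=
    (map_measureReal_apply hWh hT).symm
  rw [e0 hA]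
  rw [e1 hA] at hAz
  -- A bound for the Neyman–Pearson coefficient that is uniform over 0 ≤ v ≤ d. It lets `δ` be fixed
  -- before the cylinder, and with it `v`, is known; the total error is Kδ + δ = ε.
  set K := Real.exp (|z| * d)
  have hK : 0 < K := Real.exp_pos _
  refine le_of_forall_pos_le_add fun ε hε ↦ ?_
  set δ := ε / (K + 1) with hδ
  have hδ0 : 0 < δ := by positivity
  -- Approximating under the sum makes one cylinder close to `A` under both laws.
  obtain ⟨C, hC, hCA⟩ := exists_measure_symmDiff_lt_of_generateFrom_isSetRing (μ := μ₀ + μ₁)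
    (C := measurableCylinders fun _ : TimeInterval ↦ ℝ) isSetRing_measurableCylinders
    ⟨{Set.univ}, Set.countable_singleton _, by
      simpa using univ_mem_measurableCylinders (fun _ : TimeInterval ↦ ℝ), by simp⟩
    generateFrom_measurableCylinders.symm hA (ENNReal.ofReal_pos.2 hδ0)
  obtain ⟨I, S, hS, rfl⟩ := (mem_measurableCylinders _).1 hC
  have hCm : MeasurableSet (cylinder I S : Set Path) := .of_mem_measurableCylinders hC
  have hsym {ν : Measure Path} [IsProbabilityMeasure ν] (hν : ν ≤ μ₀ + μ₁) :
      |ν.real (cylinder I S) - ν.real A| ≤ δ := by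
    refine (abs_measureReal_sub_le_measureReal_symmDiff hCm.nullMeasurableSet
      hA.nullMeasurableSet).trans ?_
    exact ENNReal.toReal_le_of_le_ofReal hδ0.le ((hν _).trans hCA.le)
  have h0 := abs_le.1 (hsym (ν := μ₀) (Measure.le_add_right le_rfl))
  have h1 := abs_le.1 (hsym (ν := μ₁) (Measure.le_add_left le_rfl))
  obtain ⟨v, hv0, hvd, hv⟩ := neymanPearson_restrict hBmeas hB I hh hd hhd z hS
  have e0' : P.real {ω | (fun t : I ↦ B (clock t) ω) ∈ S} = μ₀.real (cylinder I S) := by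
    rw [← e0 hCm]
    rfl
  have e1' : P.real {ω | (fun t : I ↦ B (clock t) ω
      + ∫ x in (-(1 / 2) : ℝ)..(t : TimeInterval), h x) ∈ S} = μ₁.real (cylinder I S) := by
    rw [← e1 hCm]
    rfl
  rw [e0', e1'] at hv
  have h2 : stdCDF (z - d) ≤ stdCDF (z - v) := stdCDF_mono (by linarith)
  have h3 : Real.exp (z * v - v ^ 2 / 2) ≤ K := by
    refine Real.exp_le_exp.2 ?_
    have : z * v ≤ |z| * d := by
      calc z * v ≤ |z| * v := by gcongr; exact le_abs_self z
        _ ≤ |z| * d := by gcongr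
    nlinarith [sq_nonneg v]
  have h4 : -(K * δ) ≤ Real.exp (z * v - v ^ 2 / 2) * (μ₁.real (cylinder I S) - stdCDF z) := by
    have := Real.exp_pos (z * v - v ^ 2 / 2)
    have : -δ ≤ μ₁.real (cylinder I S) - stdCDF z := by linarith
    nlinarith
  have h5 : ε = K * δ + δ := by
    rw [hδ]
    field_simp
  linarith

/-! ### Coverage along a segment and the length bound -/

lemma intervalIntegrable_of_mem_monotoneClass {f : ℝ → ℝ} (hf : f ∈ monotoneClass) {a b : ℝ}
    (ha : a ∈ Set.Icc (-(1 / 2) : ℝ) (1 / 2)) (hb : b ∈ Set.Icc (-(1 / 2) : ℝ) (1 / 2)) :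
    IntervalIntegrable f volume a b :=
  MonotoneOn.intervalIntegrable (hf.mono (Set.uIcc_subset_Icc ha hb))

lemma memLp_of_mem_monotoneClass {f : ℝ → ℝ} (hf : f ∈ monotoneClass) :
    MemLp f 2 timeVolume := by
  have hint : IntegrableOn f (Set.Icc (-(1 / 2) : ℝ) (1 / 2)) :=
    MonotoneOn.integrableOn_isCompact isCompact_Icc hf
  refine MemLp.of_bound hint.1 (max |f (-(1 / 2))| |f (1 / 2)|) ?_
  refine (ae_restrict_iff' measurableSet_Icc).2 (.of_forall fun x hx ↦ ?_)
  exact abs_le_max_abs_abs (hf (Set.left_mem_Icc.2 (by norm_num)) hx hx.1)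
    (hf hx (Set.right_mem_Icc.2 (by norm_num)) hx.2)

lemma add_mul_sub_mem_monotoneClass {f g : ℝ → ℝ} (hf : f ∈ monotoneClass)
    (hg : g ∈ monotoneClass) {t : ℝ} (ht : t ∈ Set.Icc (0 : ℝ) 1) :
    (fun x ↦ f x + t * (g x - f x)) ∈ monotoneClass := by
  intro x hx y hy hxy
  have h1 := hf hx hy hxy
  have h2 := hg hx hy hxy
  have h3 := mul_le_mul_of_nonneg_left h1 (sub_nonneg.2 ht.2)
  have h4 := mul_le_mul_of_nonneg_left h2 ht.1
  simp only
  linarith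

lemma whiteNoise_eq {Ω : Type*} {B : ℝ≥0 → Ω → ℝ} (n : ℝ) (f : ℝ → ℝ) (ω : Ω) :
    whiteNoise B n f ω = driftPath f + (√n)⁻¹ • noisePath B ω := rfl

lemma measurable_whiteNoise (hBmeas : ∀ t, Measurable (B t)) (n : ℝ) (f : ℝ → ℝ) :
    Measurable (whiteNoise B n f) :=
  ((measurable_noisePath hBmeas).const_smul (√n)⁻¹).const_add (driftPath f)

/-- A confidence interval with guaranteed coverage covers, at `f`, the values at `0` along the
segment from `f` to `g` with at least the probability given by the Neyman–Pearson lemma. -/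
lemma stdCDF_le_coverage [IsProbabilityMeasure P] (hBmeas : ∀ t, Measurable (B t))
    (hB : IsPreBrownianReal B P) {n α z : ℝ} (hn : 0 < n) (hα : stdCDF z = 1 - α) (hz : 0 ≤ z)
    {f g : ℝ → ℝ} (hf : f ∈ monotoneClass) (hg : g ∈ monotoneClass)
    (hfg : ∫ x in (-(1 / 2) : ℝ)..(1 / 2), (g x - f x) ^ 2 ≤ z ^ 2 / n)
    {C : IntervalProcedure} (hC : C ∈ confidenceIntervals P B n α monotoneClass)
    {t : ℝ} (ht : t ∈ Set.Icc (0 : ℝ) 1) :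
    stdCDF (z - t * z)
      ≤ P.real {ω | f 0 + t * (g 0 - f 0) ∈ C.interval (whiteNoise B n f ω)} := by
  have hsn : 0 < √n := Real.sqrt_pos.2 hn
  -- The factor √n cancels the noise level: moving along the segment is the same as adding this
  -- drift to the unscaled Brownian motion.
  set h : ℝ → ℝ := fun x ↦ √n * t * (g x - f x) with hh
  have hhmem : MemLp h 2 timeVolume :=
    ((memLp_of_mem_monotoneClass hg).sub (memLp_of_mem_monotoneClass hf)).const_mul (√n * t)
  have hhd : ∫ x in (-(1 / 2) : ℝ)..(1 / 2), h x ^ 2 ≤ (t * z) ^ 2 := by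
    have h1 (x : ℝ) : h x ^ 2 = n * t ^ 2 * (g x - f x) ^ 2 := by
      rw [hh, mul_pow, mul_pow, Real.sq_sqrt hn.le]
    simp_rw [h1]
    rw [intervalIntegral.integral_const_mul]
    calc n * t ^ 2 * ∫ x in (-(1 / 2) : ℝ)..(1 / 2), (g x - f x) ^ 2
        ≤ n * t ^ 2 * (z ^ 2 / n) := by gcongr
      _ = (t * z) ^ 2 := by field_simp
  set A : Set Path := {w | f 0 + t * (g 0 - f 0) ∈ C.interval (driftPath f + (√n)⁻¹ • w)} with hA
  have hAm : MeasurableSet A := by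
    have hm : Measurable fun w : Path ↦ driftPath f + (√n)⁻¹ • w :=
      (measurable_id.const_smul (√n)⁻¹).const_add (driftPath f)
    exact (measurableSet_le (C.measurable_lower.comp hm) measurable_const).inter
      (measurableSet_le measurable_const (C.measurable_upper.comp hm))
  have hdrift (ω : Ω) : whiteNoise B n (fun x ↦ f x + t * (g x - f x)) ω
      = driftPath f + (√n)⁻¹ • (noisePath B ω + driftPath h) := by
    rw [whiteNoise_eq, smul_add, add_left_comm, add_comm]
    congr 1
    ext s
    have hs := s.2
    have hl : (-(1 / 2) : ℝ) ∈ Set.Icc (-(1 / 2) : ℝ) (1 / 2) := by norm_num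
    have hif := intervalIntegrable_of_mem_monotoneClass hf hl hs
    have hig := intervalIntegrable_of_mem_monotoneClass hg hl hs
    simp only [driftPath, Pi.add_apply, Pi.smul_apply, smul_eq_mul, hh]
    rw [intervalIntegral.integral_add hif ((hig.sub hif).const_mul t),
      intervalIntegral.integral_const_mul, intervalIntegral.integral_const_mul]
    field_simp
  have hcov : stdCDF z ≤ P.real {ω | noisePath B ω + driftPath h ∈ A} := by
    have h1 := hC _ (add_mul_sub_mem_monotoneClass hf hg ht)
    simp only [hdrift] at h1
    rw [hα]
    exact (ENNReal.ofReal_le_iff_le_toReal (measure_ne_top _ _)).1 h1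
  exact stdCDF_sub_le_of_drift hBmeas hB hhmem (mul_nonneg ht.1 hz) hhd hAm hcov

/-- The two-point lower bound on the expected length. -/
lemma le_expectedLength [IsProbabilityMeasure P] (hBmeas : ∀ t, Measurable (B t))
    (hB : IsPreBrownianReal B P) {n α z : ℝ} (hn : 0 < n) (hα : stdCDF z = 1 - α) (hz : 0 < z)
    {f g : ℝ → ℝ} (hf : f ∈ monotoneClass) (hg : g ∈ monotoneClass)
    (hfg : ∫ x in (-(1 / 2) : ℝ)..(1 / 2), (g x - f x) ^ 2 ≤ z ^ 2 / n)
    {C : IntervalProcedure} (hC : C ∈ confidenceIntervals P B n α monotoneClass) :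
    ENNReal.ofReal ((1 - 1 / (√(2 * Real.pi) * z)) * |g 0 - f 0|) ≤ expectedLength P B n C f := by
  rcases eq_or_ne (g 0 - f 0) 0 with hb | hb
  · simp [hb]
  set b := g 0 - f 0 with hbdef
  have hY := measurable_whiteNoise hBmeas n f
  let T : Set (Ω × ℝ) := {p | f 0 + p.2 * b ∈ C.interval (whiteNoise B n f p.1)}
  have hT : MeasurableSet T := by
    have h1 : Measurable fun p : Ω × ℝ ↦ ((f 0 + p.2 * b : ℝ) : EReal) :=
      measurable_coe_real_ereal.comp (by fun_prop)
    have h2 : Measurable fun p : Ω × ℝ ↦ whiteNoise B n f p.1 := hY.comp measurable_fst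
    exact (measurableSet_le (C.measurable_lower.comp h2) h1).inter
      (measurableSet_le h1 (C.measurable_upper.comp h2))
  have hlen (ω : Ω) : ENNReal.ofReal |b|
        * ∫⁻ t in Set.Icc (0 : ℝ) 1, T.indicator (fun _ ↦ (1 : ℝ≥0∞)) (ω, t)
      ≤ C.length (whiteNoise B n f ω) := by
    set J := C.interval (whiteNoise B n f ω) with hJ
    -- The part of the interval between f(0) and g(0) is parametrised by t ↦ f(0) + tb, with
    -- Jacobian |b|.
    have hvol : volume ((fun t ↦ b * t) ⁻¹' ((fun x ↦ f 0 + x) ⁻¹' J))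
        = ENNReal.ofReal |b⁻¹| * volume J := by
      rw [Real.volume_preimage_mul_left hb, measure_preimage_add]
    have h1 : ∫⁻ t in Set.Icc (0 : ℝ) 1, T.indicator (fun _ ↦ (1 : ℝ≥0∞)) (ω, t)
        ≤ volume ((fun t ↦ b * t) ⁻¹' ((fun x ↦ f 0 + x) ⁻¹' J)) := by
      refine (setLIntegral_le_lintegral _ _).trans ?_
      have h2 : (fun t ↦ b * t) ⁻¹' ((fun x ↦ f 0 + x) ⁻¹' J) = Prod.mk ω ⁻¹' T := by
        ext t
        simp only [Set.mem_preimage, mul_comm b t]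
        rfl
      rw [h2]
      exact lintegral_indicator_one_le (Prod.mk ω ⁻¹' T)
    calc _ ≤ ENNReal.ofReal |b| * (ENNReal.ofReal |b⁻¹| * volume J) := by
          rw [← hvol]
          gcongr
      _ = volume J := by
          rw [← mul_assoc, ← ENNReal.ofReal_mul (abs_nonneg _), ← abs_mul, mul_inv_cancel₀ hb]
          simp
  have hcont : Continuous fun t ↦ stdCDF (z - t * z) := continuous_stdCDF.comp (by fun_prop)
  have hswap : ∫⁻ ω, (∫⁻ t in Set.Icc (0 : ℝ) 1, T.indicator (fun _ ↦ (1 : ℝ≥0∞)) (ω, t)) ∂P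
      = ∫⁻ t in Set.Icc (0 : ℝ) 1, P {ω | f 0 + t * b ∈ C.interval (whiteNoise B n f ω)} := by
    rw [lintegral_lintegral_swap (f := fun ω t ↦ T.indicator (fun _ ↦ (1 : ℝ≥0∞)) (ω, t))
      (measurable_const.indicator hT).aemeasurable]
    refine lintegral_congr fun t ↦ ?_
    exact lintegral_indicator_one (measurable_prodMk_right hT)
  have hlow : ENNReal.ofReal (1 - 1 / (√(2 * Real.pi) * z))
      ≤ ∫⁻ t in Set.Icc (0 : ℝ) 1, P {ω | f 0 + t * b ∈ C.interval (whiteNoise B n f ω)} := by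
    calc _ ≤ ENNReal.ofReal (∫ t in Set.Icc (0 : ℝ) 1, stdCDF (z - t * z)) := by
          rw [integral_Icc_eq_integral_Ioc, ← intervalIntegral.integral_of_le zero_le_one]
          exact ENNReal.ofReal_le_ofReal (one_sub_le_integral_stdCDF hz)
      _ = ∫⁻ t in Set.Icc (0 : ℝ) 1, ENNReal.ofReal (stdCDF (z - t * z)) :=
          ofReal_integral_eq_lintegral_ofReal hcont.continuousOn.integrableOn_Icc
            (.of_forall fun _ ↦ stdCDF_nonneg _)
      _ ≤ _ := by
          refine setLIntegral_mono' measurableSet_Icc fun t ht ↦ ?_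
          refine ENNReal.ofReal_le_of_le_toReal ?_
          exact stdCDF_le_coverage hBmeas hB hn hα hz.le hf hg hfg hC ht
  calc ENNReal.ofReal ((1 - 1 / (√(2 * Real.pi) * z)) * |b|)
      = ENNReal.ofReal |b| * ENNReal.ofReal (1 - 1 / (√(2 * Real.pi) * z)) := by
        rw [mul_comm, ENNReal.ofReal_mul (abs_nonneg _)]
    _ ≤ ENNReal.ofReal |b| * ∫⁻ ω, (∫⁻ t in Set.Icc (0 : ℝ) 1,
          T.indicator (fun _ ↦ (1 : ℝ≥0∞)) (ω, t)) ∂P := by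
        rw [hswap]
        gcongr
    _ = ∫⁻ ω, (ENNReal.ofReal |b| * ∫⁻ t in Set.Icc (0 : ℝ) 1,
          T.indicator (fun _ ↦ (1 : ℝ≥0∞)) (ω, t)) ∂P :=
        (lintegral_const_mul' _ _ ENNReal.ofReal_ne_top).symm
    _ ≤ expectedLength P B n C f := lintegral_mono hlen

/-! ### The means of ξ_j and the existence of j_*^m -/

lemma whiteNoise_at {Ω : Type*} {B : ℝ≥0 → Ω → ℝ} (n : ℝ) (f : ℝ → ℝ) {t : ℝ} (ht : t ∈ Set.Icc (-(1 / 2) : ℝ) (1 / 2)) :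
    (fun ω ↦ (whiteNoise B n f ω).at t)
      = fun ω ↦ (∫ s in (-(1 / 2) : ℝ)..t, f s) + (√n)⁻¹ * B (clock ⟨t, ht⟩) ω := by
  ext ω
  rw [Path.at, Set.projIcc_of_mem _ ht]
  rfl

lemma integrable_whiteNoise_at [IsProbabilityMeasure P] (hB : IsPreBrownianReal B P) (n : ℝ)
    (f : ℝ → ℝ) {t : ℝ} (ht : t ∈ Set.Icc (-(1 / 2) : ℝ) (1 / 2)) :
    Integrable (fun ω ↦ (whiteNoise B n f ω).at t) P := by
  rw [whiteNoise_at n f ht]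
  exact (integrable_const _).add ((hB.integrable_eval _).const_mul _)

lemma integral_whiteNoise_at [IsProbabilityMeasure P] (hB : IsPreBrownianReal B P) (n : ℝ)
    (f : ℝ → ℝ) {t : ℝ} (ht : t ∈ Set.Icc (-(1 / 2) : ℝ) (1 / 2)) :
    ∫ ω, (whiteNoise B n f ω).at t ∂P = ∫ s in (-(1 / 2) : ℝ)..t, f s := by
  rw [whiteNoise_at n f ht, integral_add (integrable_const _) ((hB.integrable_eval _).const_mul _),
    integral_const_mul, hB.integral_eval]
  simp

lemma integral_sub_integral_of_mem_monotoneClass {f : ℝ → ℝ} (hf : f ∈ monotoneClass) {a b : ℝ}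
    (ha : a ∈ Set.Icc (-(1 / 2) : ℝ) (1 / 2)) (hb : b ∈ Set.Icc (-(1 / 2) : ℝ) (1 / 2)) :
    (∫ s in (-(1 / 2) : ℝ)..b, f s) - ∫ s in (-(1 / 2) : ℝ)..a, f s = ∫ s in a..b, f s := by
  have hl : (-(1 / 2) : ℝ) ∈ Set.Icc (-(1 / 2) : ℝ) (1 / 2) := by norm_num
  exact intervalIntegral.integral_interval_sub_left
    (intervalIntegrable_of_mem_monotoneClass hf hl hb)
    (intervalIntegrable_of_mem_monotoneClass hf hl ha)

/-- The mean of `ξ_j` is at most half the increment of `f` over `[-2^{-j+1}, 2^{-j+1}]`. -/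
lemma meanXi_le [IsProbabilityMeasure P] (hB : IsPreBrownianReal B P) (n : ℝ) {f : ℝ → ℝ}
    (hf : f ∈ monotoneClass) {j : ℕ} (hj : 2 ≤ j) :
    meanXi P B n f j ≤ (f ((2 : ℝ) ^ (-(j : ℤ) + 1)) - f (-(2 : ℝ) ^ (-(j : ℤ) + 1))) / 2 := by
  set r : ℝ := (2 : ℝ) ^ (-(j : ℤ)) with hr
  have hr0 : 0 < r := by positivity
  have hr4 : r ≤ 1 / 4 := by
    have : r ≤ (2 : ℝ) ^ (-2 : ℤ) := zpow_le_zpow_right₀ (by norm_num) (by omega)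
    norm_num at this
    linarith
  have e1 : (2 : ℝ) ^ (-(j : ℤ) + 1) = 2 * r := by
    rw [zpow_add₀ two_ne_zero, zpow_one, mul_comm]
  have e2 : (2 : ℝ) ^ ((j : ℤ) - 1) = (2 * r)⁻¹ := by
    rw [← e1, ← zpow_neg]
    congr 1
    ring
  have m1 : 2 * r ∈ Set.Icc (-(1 / 2) : ℝ) (1 / 2) := ⟨by linarith, by linarith⟩
  have m2 : r ∈ Set.Icc (-(1 / 2) : ℝ) (1 / 2) := ⟨by linarith, by linarith⟩
  have m3 : -r ∈ Set.Icc (-(1 / 2) : ℝ) (1 / 2) := ⟨by linarith, by linarith⟩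
  have m4 : -(2 * r) ∈ Set.Icc (-(1 / 2) : ℝ) (1 / 2) := ⟨by linarith, by linarith⟩
  have i1 := integrable_whiteNoise_at hB n f m1
  have i2 := integrable_whiteNoise_at hB n f m2
  have i3 := integrable_whiteNoise_at hB n f m3
  have i4 := integrable_whiteNoise_at hB n f m4
  have i12 : Integrable (fun ω ↦ (2 * r)⁻¹ *
      ((whiteNoise B n f ω).at (2 * r) - (whiteNoise B n f ω).at r)) P := (i1.sub i2).const_mul _
  have i34 : Integrable (fun ω ↦ (2 * r)⁻¹ *
      ((whiteNoise B n f ω).at (-r) - (whiteNoise B n f ω).at (-(2 * r)))) P :=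
    (i3.sub i4).const_mul _
  have hmean : meanXi P B n f j
      = (2 * r)⁻¹ * (∫ s in r..(2 * r), f s) - (2 * r)⁻¹ * ∫ s in (-(2 * r))..(-r), f s := by
    simp only [meanXi, xi, ← hr, e1, e2]
    rw [integral_sub i12 i34, integral_const_mul,
      integral_const_mul, integral_sub i1 i2, integral_sub i3 i4, integral_whiteNoise_at hB n f m1,
      integral_whiteNoise_at hB n f m2, integral_whiteNoise_at hB n f m3,
      integral_whiteNoise_at hB n f m4, integral_sub_integral_of_mem_monotoneClass hf m2 m1,
      integral_sub_integral_of_mem_monotoneClass hf m4 m3]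
  -- Each integral runs over length `r` but is normalised by 2r, which produces the factor one half.
  have h1 : ∫ s in r..(2 * r), f s ≤ r * f (2 * r) := by
    have := intervalIntegral.integral_mono_on (by linarith : r ≤ 2 * r)
      (intervalIntegrable_of_mem_monotoneClass hf m2 m1) intervalIntegrable_const
      (g := fun _ ↦ f (2 * r))
      fun x hx ↦ hf ⟨by linarith [hx.1], by linarith [hx.2]⟩ m1 hx.2
    simp only [intervalIntegral.integral_const, smul_eq_mul] at this
    linarith
  have h2 : r * f (-(2 * r)) ≤ ∫ s in (-(2 * r))..(-r), f s := by
    have := intervalIntegral.integral_mono_on (by linarith : -(2 * r) ≤ -r)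
      intervalIntegrable_const (intervalIntegrable_of_mem_monotoneClass hf m4 m3)
      (f := fun _ ↦ f (-(2 * r)))
      fun x hx ↦ hf m4 ⟨by linarith [hx.1], by linarith [hx.2]⟩ hx.1
    simp only [intervalIntegral.integral_const, smul_eq_mul] at this
    linarith
  rw [hmean, e1, ← mul_sub, inv_mul_le_iff₀ (by positivity)]
  linarith

lemma sigma_nonneg (n : ℝ) (j : ℕ) : 0 ≤ sigma n j := Real.sqrt_nonneg _

lemma sigma_sq {n : ℝ} (hn : 0 < n) (j : ℕ) : sigma n j ^ 2 = (2 : ℝ) ^ ((j : ℤ) - 1) / n :=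
  Real.sq_sqrt (by positivity)

lemma sigma_succ {n : ℝ} (j : ℕ) : sigma n (j + 1) = √2 * sigma n j := by
  rw [sigma, sigma, ← Real.sqrt_mul zero_le_two]
  congr 1
  rw [← mul_div_assoc, ← zpow_one_add₀ two_ne_zero]
  congr 2
  push_cast
  ring

/-- The means E ξ_j are bounded by half the total increment of f, while σ_j tends to infinity. -/
lemma levelSet_nonempty [IsProbabilityMeasure P] (hB : IsPreBrownianReal B P) {n α : ℝ}
    (hn : 0 < n) (hz : 0 < zQuantile α) {f : ℝ → ℝ} (hf : f ∈ monotoneClass) :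
    (levelSet P B n α f).Nonempty := by
  set D := (f (1 / 2) - f (-(1 / 2))) / 2
  obtain ⟨m, hm⟩ := pow_unbounded_of_one_lt (n * (D / zQuantile α) ^ 2) one_lt_two
  refine ⟨m + 2, by omega, (meanXi_le hB n hf (by omega)).trans ?_⟩
  set s : ℝ := (2 : ℝ) ^ (-((m + 2 : ℕ) : ℤ) + 1) with hs
  have hs0 : 0 < s := by positivity
  have hs1 : s ≤ 1 / 2 := by
    have : s ≤ (2 : ℝ) ^ (-1 : ℤ) := zpow_le_zpow_right₀ (by norm_num) (by omega)
    norm_num at this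
    linarith
  have hsm : s ∈ Set.Icc (-(1 / 2) : ℝ) (1 / 2) := ⟨by linarith, hs1⟩
  have hsm' : -s ∈ Set.Icc (-(1 / 2) : ℝ) (1 / 2) := ⟨by linarith, by linarith⟩
  have h1 : f s ≤ f (1 / 2) := hf hsm (by norm_num) hs1
  have h2 : f (-(1 / 2)) ≤ f (-s) := hf (by norm_num) hsm' hsm'.1
  have h3 : D / zQuantile α ≤ sigma n (m + 2) := by
    refine Real.le_sqrt_of_sq_le ?_
    rw [le_div_iff₀ hn, mul_comm]
    refine hm.le.trans ?_
    rw [← zpow_natCast]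
    exact zpow_le_zpow_right₀ (by norm_num) (by push_cast; omega)
  have h4 : D ≤ zQuantile α * sigma n (m + 2) := by
    rwa [div_le_iff₀' hz] at h3
  refine le_trans ?_ h4
  simp only [D]
  linarith

/-! ### Least favourable alternatives -/

/-- The least favourable alternative obtained by raising `f` by `a` at `0`. -/
lemma exists_raise {f : ℝ → ℝ} (hf : f ∈ monotoneClass) {a l : ℝ} (ha : 0 ≤ a) (hl₀ : 0 ≤ l)
    (hl₁ : l ≤ 1 / 2) (hal : ∀ x ≤ 1 / 2, l < x → f 0 + a ≤ f x) :
    ∃ g ∈ monotoneClass, g 0 - f 0 = a ∧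
      ∫ x in (-(1 / 2) : ℝ)..(1 / 2), (g x - f x) ^ 2 ≤ l * a ^ 2 := by
  -- The smallest monotone majorant of `f` on the time interval with value f(0) + a at 0. It differs
  -- from `f` only within [0, l], and there by at most `a`.
  set g : ℝ → ℝ := fun x ↦ if 0 ≤ x then max (f x) (f 0 + a) else f x with hg
  have hgm : g ∈ monotoneClass := by
    intro x hx y hy hxy
    have := hf hx hy hxy
    simp only [hg]
    split_ifs with h1 h2 h2
    · exact max_le_max_right _ this
    · exact absurd (h1.trans hxy) h2
    · exact this.trans (le_max_left _ _)
    · exact this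
  refine ⟨g, hgm, by simp [hg, ha], ?_⟩
  have hint : Integrable (fun x ↦ (g x - f x) ^ 2) timeVolume :=
    ((memLp_of_mem_monotoneClass hgm).sub (memLp_of_mem_monotoneClass hf)).integrable_sq
  rw [intervalIntegral.integral_of_le (by norm_num), ← integral_Icc_eq_integral_Ioc]
  calc ∫ x in Set.Icc (-(1 / 2) : ℝ) (1 / 2), (g x - f x) ^ 2
      ≤ ∫ x in Set.Icc (-(1 / 2) : ℝ) (1 / 2), (Set.Icc 0 l).indicator (fun _ ↦ a ^ 2) x := by
        refine setIntegral_mono_on hint ((integrable_const _).indicator measurableSet_Icc)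
          measurableSet_Icc fun x hx ↦ ?_
        by_cases h0 : 0 ≤ x
        · have hfx : f 0 ≤ f x := hf (by norm_num) hx h0
          by_cases hxl : x ≤ l
          · rw [Set.indicator_of_mem (Set.mem_Icc.2 ⟨h0, hxl⟩)]
            simp only [hg, h0, if_true]
            refine pow_le_pow_left₀ (sub_nonneg.2 (le_max_left _ _)) ?_ 2
            rw [sub_le_iff_le_add]
            exact max_le (by linarith) (by linarith)
          · rw [Set.indicator_of_notMem fun h ↦ hxl h.2]
            simp only [hg, h0, if_true, max_eq_left (hal x hx.2 (not_le.1 hxl))]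
            simp
        · rw [Set.indicator_of_notMem fun h ↦ h0 h.1]
          simp [hg, h0]
    _ = l * a ^ 2 := by
        rw [setIntegral_indicator measurableSet_Icc, setIntegral_const, Set.Icc_inter_Icc,
          sup_of_le_right (by norm_num), inf_of_le_right hl₁, Real.volume_real_Icc_of_le hl₀]
        simp

/-- The least favourable alternative obtained by lowering `f` by `a` at `0`. -/
lemma exists_lower {f : ℝ → ℝ} (hf : f ∈ monotoneClass) {a l : ℝ} (ha : 0 ≤ a) (hl₀ : 0 ≤ l)
    (hl₁ : l ≤ 1 / 2) (hal : ∀ x ≤ 1 / 2, l < x → f (-x) ≤ f 0 - a) :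
    ∃ g ∈ monotoneClass, g 0 - f 0 = -a ∧
      ∫ x in (-(1 / 2) : ℝ)..(1 / 2), (g x - f x) ^ 2 ≤ l * a ^ 2 := by
  -- The point reflection x ↦ -f(-x) preserves monotonicity and turns lowering into raising.
  have hreflect {f : ℝ → ℝ} (hf : f ∈ monotoneClass) : (fun x ↦ -f (-x)) ∈ monotoneClass := by
    intro x hx y hy hxy
    exact neg_le_neg (hf ⟨by linarith [hy.2], by linarith [hy.1]⟩
      ⟨by linarith [hx.2], by linarith [hx.1]⟩ (neg_le_neg hxy))
  obtain ⟨g, hg, hg0, hgi⟩ := exists_raise (hreflect hf) ha hl₀ hl₁ fun x hx hlx ↦ by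
    have := hal x hx hlx
    simp only [neg_zero]
    linarith
  refine ⟨_, hreflect hg, ?_, ?_⟩
  · simp only [neg_zero] at hg0 ⊢
    linarith
  · rw [← neg_neg (1 / 2 : ℝ), ← intervalIntegral.integral_comp_neg] at hgi
    rw [neg_neg] at hgi
    refine le_of_eq_of_le ?_ hgi
    refine intervalIntegral.integral_congr fun x _ ↦ ?_
    simp only [neg_neg]
    ring

/-- If the mean of `ξ_{j-1}` exceeds `z σ_{j-1}` or `j = 2`, then some monotone function at
`L²`-distance at most `z / √n` from `f` differs from `f` at `0` by `z σ_j / √2`. -/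
lemma exists_alternative [IsProbabilityMeasure P] (hB : IsPreBrownianReal B P) {n z : ℝ}
    (hn : 0 < n) (hz : 0 ≤ z) {f : ℝ → ℝ} (hf : f ∈ monotoneClass) {j : ℕ} (hj : 2 ≤ j)
    (hprev : 3 ≤ j → z * sigma n (j - 1) < meanXi P B n f (j - 1)) :
    ∃ g ∈ monotoneClass, |g 0 - f 0| = 1 / √2 * z * sigma n j ∧
      ∫ x in (-(1 / 2) : ℝ)..(1 / 2), (g x - f x) ^ 2 ≤ z ^ 2 / n := by
  set a : ℝ := 1 / √2 * z * sigma n j with ha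
  have ha0 : 0 ≤ a := mul_nonneg (by positivity) (sigma_nonneg _ _)
  have hasq : (2 : ℝ) ^ (2 - (j : ℤ)) * a ^ 2 = z ^ 2 / n := by
    have h2 : (2 : ℝ) ^ ((j : ℤ) - 1) = 2 / 2 ^ (2 - (j : ℤ)) := by
      rw [eq_div_iff (by positivity), ← zpow_add₀ two_ne_zero]
      norm_num
    rw [ha, mul_pow, mul_pow, sigma_sq hn, div_pow, Real.sq_sqrt zero_le_two, h2]
    field_simp
  obtain ⟨g, hg, hg0, hgi⟩ : ∃ g ∈ monotoneClass, |g 0 - f 0| = a ∧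
      ∫ x in (-(1 / 2) : ℝ)..(1 / 2), (g x - f x) ^ 2
        ≤ min (1 / 2) ((2 : ℝ) ^ (2 - (j : ℤ))) * a ^ 2 := by
    -- The minimum matters only for j = 2, where 2^{2-j} = 1 exceeds the half-length of the time
    -- interval and the condition beyond `l` is vacuous.
    set l : ℝ := min (1 / 2) ((2 : ℝ) ^ (2 - (j : ℤ))) with hl
    have hl0 : 0 ≤ l := by positivity
    have hl1 : l ≤ 1 / 2 := min_le_left _ _
    have hcase : (∀ x ≤ 1 / 2, l < x → f 0 + a ≤ f x)
        ∨ (∀ x ≤ 1 / 2, l < x → f (-x) ≤ f 0 - a) := by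
      rcases hj.eq_or_lt with rfl | hj3
      · refine .inl fun x hx hlx ↦ absurd hlx (not_lt.2 (hx.trans ?_))
        norm_num [hl]
      · obtain ⟨i, rfl⟩ : ∃ i, j = i + 1 := ⟨j - 1, by omega⟩
        have h1 := (hprev hj3).trans_le (meanXi_le hB n hf (by omega))
        simp only [Nat.add_sub_cancel] at h1
        have hai : a = z * sigma n i := by
          rw [ha, sigma_succ]
          field_simp
        have hle : (2 : ℝ) ^ (2 - ((i + 1 : ℕ) : ℤ)) = (2 : ℝ) ^ (-(i : ℤ) + 1) := by
          congr 1
          push_cast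
          ring
        set s : ℝ := (2 : ℝ) ^ (-(i : ℤ) + 1) with hs
        have hs0 : 0 < s := by positivity
        have hs1 : s ≤ 1 / 2 := by
          have : s ≤ (2 : ℝ) ^ (-1 : ℤ) := zpow_le_zpow_right₀ (by norm_num) (by omega)
          norm_num at this
          linarith
        have hls : l = s := by rw [hl, hle, min_eq_right hs1]
        rw [← hai] at h1
        rw [hls]
        -- By `h1` the increment f(s) - f(-s) exceeds 2a; if f rises by less than `a` on the right,
        -- it drops by more than `a` on the left.
        by_cases hcase : f 0 + a ≤ f s
        · exact .inl fun x hx hlx ↦ hcase.trans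
            (hf ⟨by linarith, hs1⟩ ⟨by linarith, hx⟩ hlx.le)
        · refine .inr fun x hx hlx ↦ le_trans
            (hf ⟨by linarith, by linarith⟩ ⟨by linarith, by linarith⟩ (neg_le_neg hlx.le)) ?_
          linarith
    rcases hcase with h | h
    · obtain ⟨g, hg, hg0, hgi⟩ := exists_raise hf ha0 hl0 hl1 h
      exact ⟨g, hg, by rw [hg0, abs_of_nonneg ha0], hgi⟩
    · obtain ⟨g, hg, hg0, hgi⟩ := exists_lower hf ha0 hl0 hl1 h
      exact ⟨g, hg, by rw [hg0, abs_neg, abs_of_nonneg ha0], hgi⟩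
  refine ⟨g, hg, hg0, hgi.trans ?_⟩
  rw [← hasq]
  gcongr
  exact min_le_right _ _

end MonotoneCI

end

theorem theorem3 {Ω : Type*} [MeasurableSpace Ω] (P : Measure Ω) [IsProbabilityMeasure P]
    (B : ℝ≥0 → Ω → ℝ) (hBmeas : ∀ t, Measurable (B t)) (hB : IsBrownianReal B P)
    (n : ℝ) (hn : 0 < n) (α : ℝ) (hα₀ : 0 < α) (hα₁ : α ≤ 0.2)
    (f : ℝ → ℝ) (hf : f ∈ MonotoneCI.monotoneClass) :
    IsLeast (MonotoneCI.levelSet P B n α f) (MonotoneCI.jStar P B n α f) ∧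
    ENNReal.ofReal
        ((1 - 1 / (Real.sqrt (2 * Real.pi) * MonotoneCI.zQuantile α)) * (1 / Real.sqrt 2)
          * MonotoneCI.zQuantile α * MonotoneCI.sigma n (MonotoneCI.jStar P B n α f))
      ≤ MonotoneCI.minExpectedLength P B n α f MonotoneCI.monotoneClass := by
  obtain ⟨hz, hΦ⟩ := MonotoneCI.stdCDF_zQuantile hα₀ (by norm_num at hα₁; linarith)
  have hB' := hB.toIsPreBrownianReal
  have hleast : IsLeast (MonotoneCI.levelSet P B n α f) (MonotoneCI.jStar P B n α f) :=
    ⟨Nat.sInf_mem (MonotoneCI.levelSet_nonempty hB' hn hz hf), fun _ hj ↦ Nat.sInf_le hj⟩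
  refine ⟨hleast, ?_⟩
  -- When j_*^m ≥ 3 the preceding level is still at least 2, so minimality excludes it from the
  -- level set.
  obtain ⟨g, hg, hg0, hgi⟩ := MonotoneCI.exists_alternative hB' hn hz.le hf hleast.1.1 fun h3 ↦ by
    by_contra! h
    have := hleast.2 ⟨by omega, h⟩
    omega
  refine le_iInf₂ fun C hC ↦ ?_
  have := MonotoneCI.le_expectedLength hBmeas hB' hn hΦ hz hf hg hgi hC
  rw [hg0] at this
  refine (le_of_eq (congrArg ENNReal.ofReal ?_)).trans this
  ring
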